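/- Let $k$ be a field, let $\Gamma$ be a finite group, and let $R$ be a Hopf algebra in the braided category of left Yetter--Drinfeld modules over the group algebra $k\Gamma$, with coaction $\delta:R\to k\Gamma\otimes R$, $\delta(r)=r_{(-1)}\otimes r_{(0)}$. Suppose that $R$ is an ET-algebra: its coradical (the sum of its simple subcoalgebras) is $k1$, and $R$ is generated as an algebra by the space of its primitive elements $P(R)=\{r\in R\mid \Delta(r)=1\otimes r+r\otimes 1\}$. Suppose further that, as a Yetter--Drinfeld module, $P(R)\cong M(g,\rho)$ for some $g\in\Gamma$ and some irreducible representation $\rho$ of the centralizer $\Gamma_g$ on a space $V$. Here $M(g,\rho)=k\Gamma\otimes_{k\Gamma_g}V$ with action $h(x\otimes v)=hx\otimes v$ and coaction $\delta(x\otimes v)=xgx^{-1}\otimes(x\otimes v)$. Let $G$ be the subgroup of $\Gamma$ generated by the conjugacy class of $g$; it is normal. Then $\delta(R)\subseteq kG\otimes R$, and with the restricted action, this coaction and the same multiplication, comultiplication and antipode, $R$ is a Hopf algebra in the category of Yetter--Drinfeld modules over $kG$. The bosonization $R\#k\Gamma$ (the Hopf algebra $R\otimes k\Gamma$ with $(r\#x)(s\#y)=r(x\cdot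 s)\#xy$ and $\Delta(r\#x)=\big(r_{(1)}\#(r_{(2)})_{(-1)}x\big)\otimes\big((r_{(2)})_{(0)}\#x\big)$ for $x,y\in\Gamma$) is an extension of the bosonization $R\#kG$ by the group algebra $k(\Gamma/G)$. That is, the maps $$\iota:R\#kG\to R\#k\Gamma,\quad \iota(r\#x)=r\#x,\qquad \pi:R\#k\Gamma\to k(\Gamma/G),\quad \pi(r\#x)=\varepsilon(r)\,xG,$$ are Hopf algebra morphisms forming an exact sequence $k\to R\#kG\to R\#k\Gamma\to k(\Gamma/G)\to k$: $\iota$ is injective, $\pi$ is surjective, and, writing $B=R\#k\Gamma$, $A=\iota(R\#kG)$ and $A^+=A\cap\ker\varepsilon$, one has $\ker\pi=BA^+=A^+B$ and $$A=\{b\in B\mid(\pi\otimes\mathrm{id})\Delta(b)=1\otimes b\}=\{b\in B\mid(\mathrm{id}\otimes\pi)\Delta(b)=b\otimes 1\}.$$ -/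

import Mathlib

open TensorProduct
open scoped MonoidAlgebra

noncomputable section

namespace BraidedHopf

section GroupTensor

variable {k Γ M N : Type*} [Field k] [AddCommGroup M] [Module k M]
  [AddCommGroup N] [Module k N]

/-- The linear map `kΓ ⊗ M → N` with `x ⊗ m ↦ f x m` for `x` in the group `Γ`. -/
def groupLift (f : Γ → M →ₗ[k] N) : k[Γ] ⊗[k] M →ₗ[k] N :=
  TensorProduct.lift
    (Finsupp.linearCombination k f ∘ₗ (MonoidAlgebra.coeffLinearEquiv k).toLinearMap)

@[simp]
theorem groupLift_single (f : Γ → M →ₗ[k] N) (x : Γ) (a : k) (m : M) :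
    groupLift f (MonoidAlgebra.single x a ⊗ₜ[k] m) = a • f x m := by
  simp [groupLift]

theorem tensor_induction {p : k[Γ] ⊗[k] M → Prop} (z : k[Γ] ⊗[k] M)
    (add : ∀ a b, p a → p b → p (a + b)) (zero : p 0)
    (tmul : ∀ x m, p (MonoidAlgebra.single x (1 : k) ⊗ₜ[k] m)) : p z := by
  induction z using TensorProduct.induction_on with
  | zero => exact zero
  | add a b ha hb => exact add a b ha hb
  | tmul h m =>
    induction h using MonoidAlgebra.induction_linear with
    | zero => simpa using zero
    | add a b ha hb => rw [TensorProduct.add_tmul]; exact add _ _ ha hb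
    | single x a =>
      have : (MonoidAlgebra.single x a : k[Γ]) = a • MonoidAlgebra.single x 1 := by simp
      rw [this, TensorProduct.smul_tmul]
      exact tmul x _

/-- `h ↦ x h x⁻¹` on the group algebra. -/
def conj (k : Type*) {Γ : Type*} [Field k] [Group Γ] (x : Γ) : k[Γ] →ₗ[k] k[Γ] :=
  LinearMap.mulLeft k (MonoidAlgebra.single x 1) ∘ₗ
    LinearMap.mulRight k (MonoidAlgebra.single x⁻¹ 1)

@[simp]
theorem conj_single [Group Γ] (x y : Γ) (a : k) :
    conj k x (MonoidAlgebra.single y a) = MonoidAlgebra.single (x * y * x⁻¹) a := by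
  simp [conj, mul_assoc]

end GroupTensor

/-- A left Yetter--Drinfeld module structure over the group algebra `kΓ` on a vector space `M`:
an action of `Γ` (that is, a `kΓ`-module structure), a left `kΓ`-comodule structure
`δ : M → kΓ ⊗ M`, and the compatibility `δ(x m) = x m₍₋₁₎ x⁻¹ ⊗ x m₍₀₎` for `x ∈ Γ`. -/
structure YetterDrinfeld (k Γ M : Type*) [Field k] [Group Γ] [AddCommGroup M] [Module k M] where
  act : Representation k Γ M
  coact : M →ₗ[k] k[Γ] ⊗[k] M
  coact_coassoc : (TensorProduct.assoc k k[Γ] k[Γ] M).toLinearMap ∘ₗ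
    (Coalgebra.comul (R := k) (A := k[Γ])).rTensor M ∘ₗ coact = coact.lTensor k[Γ] ∘ₗ coact
  coact_counit : (TensorProduct.lid k M).toLinearMap ∘ₗ
    (Coalgebra.counit (R := k) (A := k[Γ])).rTensor M ∘ₗ coact = LinearMap.id
  coact_act : ∀ x : Γ, coact ∘ₗ act x = TensorProduct.map (conj k x) (act x) ∘ₗ coact

namespace YetterDrinfeld

variable {k Γ M N : Type*} [Field k] [Group Γ] [AddCommGroup M] [Module k M]
  [AddCommGroup N] [Module k N]

/-- Morphisms of Yetter--Drinfeld modules: linear maps that are equivariant and colinear. -/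
structure IsHom (X : YetterDrinfeld k Γ M) (Y : YetterDrinfeld k Γ N) (f : M →ₗ[k] N) :
    Prop where
  map_act : ∀ x : Γ, f ∘ₗ X.act x = Y.act x ∘ₗ f
  map_coact : Y.coact ∘ₗ f = f.lTensor k[Γ] ∘ₗ X.coact

/-- The codiagonal coaction on `M ⊗ N`: `m ⊗ n ↦ m₍₋₁₎ n₍₋₁₎ ⊗ (m₍₀₎ ⊗ n₍₀₎)`. -/
def tensorCoact (X : YetterDrinfeld k Γ M) (Y : YetterDrinfeld k Γ N) :
    M ⊗[k] N →ₗ[k] k[Γ] ⊗[k] (M ⊗[k] N) :=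
  (LinearMap.mul' k k[Γ]).rTensor (M ⊗[k] N) ∘ₗ
    (TensorProduct.tensorTensorTensorComm k k[Γ] M k[Γ] N).toLinearMap ∘ₗ
    TensorProduct.map X.coact Y.coact

/-- The braiding `c(m ⊗ n) = m₍₋₁₎ n ⊗ m₍₀₎`. -/
def braiding (X : YetterDrinfeld k Γ M) (Y : YetterDrinfeld k Γ N) :
    M ⊗[k] N →ₗ[k] N ⊗[k] M :=
  groupLift (fun g => (Y.act g).rTensor M ∘ₗ (TensorProduct.comm k M N).toLinearMap) ∘ₗ
    (TensorProduct.assoc k k[Γ] M N).toLinearMap ∘ₗ X.coact.rTensor N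

end YetterDrinfeld

/-- A Hopf algebra in the braided category of Yetter--Drinfeld modules over `kΓ`, on the space `R`
carrying a given (associative, unital) algebra and (coassociative, counital) coalgebra structure:
a Yetter--Drinfeld structure for which the unit, multiplication, counit and comultiplication are
morphisms, the bialgebra axioms with respect to the braiding, and an antipode which is a morphism.
The tensor product carries the diagonal action and the codiagonal coaction, the unit object `k` the
trivial ones. -/
structure BraidedHopfAlgebra (k Γ R : Type*) [Field k] [Group Γ] [Ring R] [Algebra k R]
    [Coalgebra k R] extends YetterDrinfeld k Γ R where
  act_one : ∀ x : Γ, act x 1 = 1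
  coact_one : coact 1 = 1 ⊗ₜ[k] 1
  act_mul : ∀ (x : Γ) (r s : R), act x (r * s) = act x r * act x s
  coact_mul : coact ∘ₗ LinearMap.mul' k R =
    (LinearMap.mul' k R).lTensor k[Γ] ∘ₗ toYetterDrinfeld.tensorCoact toYetterDrinfeld
  counit_act : ∀ (x : Γ) (r : R), Coalgebra.counit (R := k) (act x r) = Coalgebra.counit (R := k) r
  counit_coact : ∀ r : R, (Coalgebra.counit (R := k) (A := R)).lTensor k[Γ] (coact r) =
    1 ⊗ₜ[k] Coalgebra.counit (R := k) r
  comul_act : ∀ x : Γ, Coalgebra.comul (R := k) ∘ₗ act x =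
    TensorProduct.map (act x) (act x) ∘ₗ Coalgebra.comul (R := k)
  comul_coact : (Coalgebra.comul (R := k) (A := R)).lTensor k[Γ] ∘ₗ coact =
    toYetterDrinfeld.tensorCoact toYetterDrinfeld ∘ₗ Coalgebra.comul (R := k)
  counit_one : Coalgebra.counit (R := k) (1 : R) = 1
  counit_mul : ∀ r s : R, Coalgebra.counit (R := k) (r * s) =
    Coalgebra.counit (R := k) r * Coalgebra.counit (R := k) s
  comul_one : Coalgebra.comul (R := k) (1 : R) = 1 ⊗ₜ[k] 1
  /-- `Δ m = (m ⊗ m)(id ⊗ c ⊗ id)(Δ ⊗ Δ)` -/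
  comul_mul : Coalgebra.comul (R := k) ∘ₗ LinearMap.mul' k R =
    TensorProduct.map (LinearMap.mul' k R) (LinearMap.mul' k R) ∘ₗ
      (TensorProduct.assoc k R R (R ⊗[k] R)).symm.toLinearMap ∘ₗ
      ((TensorProduct.assoc k R R R).toLinearMap ∘ₗ
        (toYetterDrinfeld.braiding toYetterDrinfeld).rTensor R ∘ₗ
        (TensorProduct.assoc k R R R).symm.toLinearMap).lTensor R ∘ₗ
      (TensorProduct.assoc k R R (R ⊗[k] R)).toLinearMap ∘ₗ
      TensorProduct.map (Coalgebra.comul (R := k)) (Coalgebra.comul (R := k))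
  antipode : R →ₗ[k] R
  antipode_hom : toYetterDrinfeld.IsHom toYetterDrinfeld antipode
  antipode_left : LinearMap.mul' k R ∘ₗ antipode.rTensor R ∘ₗ Coalgebra.comul (R := k) =
    Algebra.linearMap k R ∘ₗ Coalgebra.counit (R := k)
  antipode_right : LinearMap.mul' k R ∘ₗ antipode.lTensor R ∘ₗ Coalgebra.comul (R := k) =
    Algebra.linearMap k R ∘ₗ Coalgebra.counit (R := k)

/-- The space `P(R)` of primitive elements. -/
def primitives (k R : Type*) [Field k] [Ring R] [Algebra k R] [Coalgebra k R] : Submodule k R where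
  carrier := {r | Coalgebra.comul (R := k) r = 1 ⊗ₜ[k] r + r ⊗ₜ[k] 1}
  add_mem' {a b} ha hb := by
    simp only [Set.mem_ofPred_eq] at *
    rw [map_add, ha, hb, TensorProduct.tmul_add, TensorProduct.add_tmul]
    abel
  zero_mem' := by simp
  smul_mem' c a ha := by
    simp only [Set.mem_ofPred_eq] at *
    rw [map_smul, ha, smul_add, TensorProduct.tmul_smul, ← TensorProduct.smul_tmul']

/-- A subspace `C` of a coalgebra with `Δ(C) ⊆ C ⊗ C`. -/
def IsSubcoalgebra {k R : Type*} [Field k] [AddCommGroup R] [Module k R] [Coalgebra k R]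
    (C : Submodule k R) : Prop :=
  ∀ c ∈ C, Coalgebra.comul (R := k) c ∈ LinearMap.range (TensorProduct.map C.subtype C.subtype)

/-- A nonzero subcoalgebra without subcoalgebras other than `0` and itself. -/
def IsSimpleSubcoalgebra {k R : Type*} [Field k] [AddCommGroup R] [Module k R] [Coalgebra k R]
    (C : Submodule k R) : Prop :=
  IsSubcoalgebra C ∧ C ≠ ⊥ ∧ ∀ C' : Submodule k R, IsSubcoalgebra C' → C' ≤ C → C' = ⊥ ∨ C' = C

/-- The coradical: the sum of all simple subcoalgebras. -/
def coradical (k R : Type*) [Field k] [AddCommGroup R] [Module k R] [Coalgebra k R] :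
    Submodule k R :=
  sSup {C | IsSimpleSubcoalgebra C}

namespace BraidedHopfAlgebra

variable {k Γ R : Type*} [Field k] [Group Γ] [Ring R] [Algebra k R] [Coalgebra k R]

/-- The underlying space `R ⊗ kΓ = ⨁_{x ∈ Γ} R ⊗ x` of the bosonization `R # kΓ`;
the element `r # x` is `Finsupp.single x r`. -/
def Bosonization (_D : BraidedHopfAlgebra k Γ R) : Type _ := Γ →₀ R

variable (D : BraidedHopfAlgebra k Γ R)

instance : AddCommGroup D.Bosonization := inferInstanceAs (AddCommGroup (Γ →₀ R))

instance : Module k D.Bosonization := inferInstanceAs (Module k (Γ →₀ R))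

/-- `r ↦ r # x` -/
def smash (x : Γ) : R →ₗ[k] D.Bosonization := Finsupp.lsingle (M := R) (R := k) x

/-- Linear maps on `R # kΓ` given on each summand `R # x`. -/
def bosonLift {N : Type*} [AddCommGroup N] [Module k N] (f : Γ → R →ₗ[k] N) :
    D.Bosonization →ₗ[k] N :=
  Finsupp.lsum k (M := R) f

@[simp]
theorem bosonLift_smash {N : Type*} [AddCommGroup N] [Module k N] (f : Γ → R →ₗ[k] N) (x : Γ)
    (r : R) : D.bosonLift f (D.smash x r) = f x r := by
  change Finsupp.lsum k (M := R) f (Finsupp.single x r) = f x r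
  simp

@[ext high]
theorem boson_hom_ext {N : Type*} [AddCommGroup N] [Module k N] {f g : D.Bosonization →ₗ[k] N}
    (h : ∀ x, f ∘ₗ D.smash x = g ∘ₗ D.smash x) : f = g :=
  Finsupp.lhom_ext' (M := R) h

/-- Multiplication of `R # kΓ`: `(r # x)(s # y) = r (x s) # x y`. -/
def bosonMul : D.Bosonization →ₗ[k] D.Bosonization →ₗ[k] D.Bosonization :=
  D.bosonLift fun x => (D.bosonLift fun y =>
    (((LinearMap.mul k R).compl₂ (D.act x)).compr₂ (D.smash (x * y))).flip).flip

instance : Mul D.Bosonization := ⟨fun a b => D.bosonMul a b⟩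

instance : One D.Bosonization := ⟨D.smash 1 1⟩

theorem boson_mul_def (a b : D.Bosonization) : a * b = D.bosonMul a b := rfl

theorem boson_one_def : (1 : D.Bosonization) = D.smash 1 1 := rfl

@[simp]
theorem smash_mul_smash (x y : Γ) (r s : R) :
    D.smash x r * D.smash y s = D.smash (x * y) (r * D.act x s) := by
  simp [boson_mul_def, bosonMul]

theorem boson_induction {p : D.Bosonization → Prop} (a : D.Bosonization) (zero : p 0)
    (add : ∀ a b, p a → p b → p (a + b)) (smash : ∀ x r, p (D.smash x r)) : p a :=
  Finsupp.induction_linear (M := R) a zero add smash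

instance : Ring D.Bosonization :=
  { (inferInstance : AddCommGroup D.Bosonization), (inferInstance : Mul D.Bosonization),
    (inferInstance : One D.Bosonization) with
    left_distrib := fun a b c => map_add (D.bosonMul a) b c
    right_distrib := fun a b c => by simp [boson_mul_def]
    zero_mul := fun a => by simp [boson_mul_def]
    mul_zero := fun a => by simp [boson_mul_def]
    one_mul := fun a => by
      have : D.bosonMul 1 = LinearMap.id := by
        ext x r
        simp [boson_one_def, ← boson_mul_def]
      simp [boson_mul_def, this]
    mul_one := fun a => by
      have : D.bosonMul.flip 1 = LinearMap.id := by
        ext x r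
        simp [boson_one_def, ← boson_mul_def, D.act_one]
      rw [boson_mul_def, ← LinearMap.flip_apply, this, LinearMap.id_apply]
    mul_assoc := fun a b c => by
      simp only [boson_mul_def]
      induction a using D.boson_induction with
      | zero => simp
      | add a a' h h' => simp [h, h']
      | smash x r =>
      induction b using D.boson_induction with
      | zero => simp
      | add a a' h h' => simp [h, h']
      | smash y s =>
      induction c using D.boson_induction with
      | zero => simp
      | add a a' h h' => simp [h, h']
      | smash z t => simp [← boson_mul_def, D.act_mul, mul_assoc] }

instance : Algebra k D.Bosonization :=
  Algebra.ofModule (fun a b c => by simp [boson_mul_def]) (fun a b c => by simp [boson_mul_def])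

/-- Comultiplication of `R # kΓ`:
`Δ(r # x) = (r₍₁₎ # (r₍₂₎)₍₋₁₎ x) ⊗ ((r₍₂₎)₍₀₎ # x)`. -/
def bosonComul : D.Bosonization →ₗ[k] D.Bosonization ⊗[k] D.Bosonization :=
  D.bosonLift fun x =>
    groupLift (fun g => TensorProduct.map (D.smash (g * x)) (D.smash x)) ∘ₗ
      (TensorProduct.leftComm k R k[Γ] R).toLinearMap ∘ₗ
      D.coact.lTensor R ∘ₗ Coalgebra.comul (R := k)

/-- Counit of `R # kΓ`: `ε(r # x) = ε(r)`. -/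
def bosonCounit : D.Bosonization →ₗ[k] k := D.bosonLift fun _ => Coalgebra.counit (R := k)

/-- Antipode of `R # kΓ`: `S(r # x) = (1 # x⁻¹)(1 # (r₍₋₁₎)⁻¹)(S(r₍₀₎) # 1)`. -/
def bosonAntipode : D.Bosonization →ₗ[k] D.Bosonization :=
  D.bosonLift fun x =>
    groupLift (fun g => D.smash (x⁻¹ * g⁻¹) ∘ₗ D.act (x⁻¹ * g⁻¹) ∘ₗ D.antipode) ∘ₗ D.coact

/-- The homogeneous component of degree `g`. -/
def comp (g : Γ) : R →ₗ[k] R :=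
  open Classical in groupLift (fun h => if h = g then LinearMap.id else 0) ∘ₗ D.coact

theorem coact_eq [Fintype Γ] (r : R) :
    D.coact r = ∑ g, MonoidAlgebra.single g (1 : k) ⊗ₜ[k] D.comp g r := by
  classical
  simp only [comp, LinearMap.comp_apply]
  generalize D.coact r = z
  induction z using tensor_induction with
  | zero => simp
  | add a b ha hb => simp only [map_add, TensorProduct.tmul_add, Finset.sum_add_distrib, ← ha, ← hb]
  | tmul x m => 
    rw [Finset.sum_eq_single x]
    · simp
    · intro b _ hb
      simp [hb.symm]
    · simp

theorem coeff_ext [Fintype Γ] {N : Type*} [AddCommGroup N] [Module k N] {f g : Γ → N}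
    (h : ∑ x, MonoidAlgebra.single x (1 : k) ⊗ₜ[k] f x =
      ∑ x, MonoidAlgebra.single x (1 : k) ⊗ₜ[k] g x) (x : Γ) : f x = g x := by
  classical
  have := congrArg (groupLift (k := k) (M := N) (fun y => if y = x then LinearMap.id else 0)) h
  have e : ∀ (v : Γ → N) (y : Γ), (if y = x then LinearMap.id else 0 : N →ₗ[k] N) (v y) =
      if y = x then v y else 0 := fun v y => by split <;> rfl
  simpa [e] using this

theorem groupLift_coact [Fintype Γ] {N : Type*} [AddCommGroup N] [Module k N]
    (f : Γ → R →ₗ[k] N) (r : R) : groupLift f (D.coact r) = ∑ g, f g (D.comp g r) := by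
  simp [coact_eq]

theorem comp_comp [Fintype Γ] [DecidableEq Γ] (g h : Γ) (r : R) :
    D.comp g (D.comp h r) = if g = h then D.comp h r else 0 := by
  have := LinearMap.congr_fun D.coact_coassoc r
  simp only [LinearMap.comp_apply, coact_eq, map_sum, LinearMap.rTensor_tmul,
    LinearMap.lTensor_tmul, MonoidAlgebra.comul_single] at this
  simp at this
  have h1 := coeff_ext (k := k) this h
  have h2 : ∑ u, MonoidAlgebra.single u (1 : k) ⊗ₜ[k] (if u = h then D.comp h r else 0) =
      ∑ u, MonoidAlgebra.single u (1 : k) ⊗ₜ[k] D.comp u (D.comp h r) := by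
    rw [← h1, Finset.sum_eq_single h]
    · simp
    · intro b _ hb
      simp [hb]
    · simp
  exact (coeff_ext (k := k) h2 g).symm

theorem sum_comp [Fintype Γ] (r : R) : ∑ g, D.comp g r = r := by
  have := LinearMap.congr_fun D.coact_counit r
  simpa [coact_eq] using this

theorem comp_act (g x : Γ) (r : R) :
    D.comp g (D.act x r) = D.act x (D.comp (x⁻¹ * g * x) r) := by
  classical
  have := LinearMap.congr_fun (D.coact_act x) r
  simp only [LinearMap.comp_apply] at this
  simp only [comp, LinearMap.comp_apply, this]
  generalize D.coact r = z
  induction z using tensor_induction with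
  | zero => simp
  | add a b ha hb => simp only [map_add, ha, hb]
  | tmul y m =>
    have : x * y * x⁻¹ = g ↔ y = x⁻¹ * g * x := by
      constructor
      · rintro rfl; group
      · rintro rfl; group
    by_cases h : y = x⁻¹ * g * x
    · simp only [TensorProduct.map_tmul, conj_single, groupLift_single, one_smul, if_pos h,
        if_pos (this.2 h), LinearMap.id_apply]
    · simp [this, h]

theorem tensorCoact_eq [Fintype Γ] (z : R ⊗[k] R) :
    D.tensorCoact D.toYetterDrinfeld z = ∑ g, MonoidAlgebra.single g (1 : k) ⊗ₜ[k]
      ∑ u, TensorProduct.map (D.comp u) (D.comp (u⁻¹ * g)) z := by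
  induction z using TensorProduct.induction_on with
  | zero => simp
  | add a b ha hb =>
    simp only [map_add, ha, hb, Finset.sum_add_distrib, TensorProduct.tmul_add]
  | tmul a b =>
    simp only [YetterDrinfeld.tensorCoact, LinearMap.comp_apply, TensorProduct.map_tmul, coact_eq,
      TensorProduct.sum_tmul, TensorProduct.tmul_sum, map_sum, LinearEquiv.coe_coe,
      TensorProduct.tensorTensorTensorComm_tmul, LinearMap.rTensor_tmul, LinearMap.mul'_apply,
      MonoidAlgebra.single_mul_single, mul_one]
    rw [Finset.sum_comm' (t' := Finset.univ) (s' := fun _ => Finset.univ) (by simp)]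
    conv_rhs => rw [Finset.sum_comm]
    refine Finset.sum_congr rfl fun u _ => ?_
    conv_rhs => rw [← Equiv.sum_comp (Equiv.mulLeft u)]
    simp

theorem comp_mul [Fintype Γ] (g : Γ) (r s : R) :
    D.comp g (r * s) = ∑ u, D.comp u r * D.comp (u⁻¹ * g) s := by
  have := LinearMap.congr_fun D.coact_mul (r ⊗ₜ s)
  simp only [LinearMap.comp_apply, tensorCoact_eq, coact_eq, map_sum, LinearMap.lTensor_tmul,
    LinearMap.mul'_apply, TensorProduct.map_tmul] at this
  exact coeff_ext (k := k) this g

theorem comp_one [Fintype Γ] [DecidableEq Γ] (g : Γ) : D.comp g 1 = if g = 1 then 1 else 0 := by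
  have : ∑ u, MonoidAlgebra.single u (1 : k) ⊗ₜ[k] D.comp u 1 =
      ∑ u, MonoidAlgebra.single u (1 : k) ⊗ₜ[k] (if u = 1 then (1 : R) else 0) := by
    rw [← coact_eq, D.coact_one, Finset.sum_eq_single 1]
    · simp [MonoidAlgebra.one_def]
    · intro b _ hb
      simp [hb]
    · simp
  exact coeff_ext (k := k) this g

theorem comul_comp [Fintype Γ] (g : Γ) (r : R) :
    Coalgebra.comul (R := k) (D.comp g r) =
      ∑ u, TensorProduct.map (D.comp u) (D.comp (u⁻¹ * g)) (Coalgebra.comul (R := k) r) := by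
  have := LinearMap.congr_fun D.comul_coact r
  simp only [LinearMap.comp_apply, tensorCoact_eq, coact_eq, map_sum, LinearMap.lTensor_tmul] at this
  exact coeff_ext (k := k) this g

theorem counit_comp [Fintype Γ] [DecidableEq Γ] (g : Γ) (r : R) :
    Coalgebra.counit (R := k) (D.comp g r) = if g = 1 then Coalgebra.counit (R := k) r else 0 := by
  have := D.counit_coact r
  simp only [coact_eq, map_sum, LinearMap.lTensor_tmul] at this
  have h2 : ∑ u, MonoidAlgebra.single u (1 : k) ⊗ₜ[k] Coalgebra.counit (R := k) (D.comp u r) =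
      ∑ u, MonoidAlgebra.single u (1 : k) ⊗ₜ[k]
        (if u = 1 then Coalgebra.counit (R := k) r else 0) := by
    rw [this, Finset.sum_eq_single 1]
    · simp [MonoidAlgebra.one_def]
    · intro b _ hb
      simp [hb]
    · simp
  exact coeff_ext (k := k) h2 g

theorem antipode_comp [Fintype Γ] (g : Γ) (r : R) :
    D.antipode (D.comp g r) = D.comp g (D.antipode r) := by
  have := LinearMap.congr_fun D.antipode_hom.map_coact r
  simp only [LinearMap.comp_apply, coact_eq, map_sum, LinearMap.lTensor_tmul] at this
  exact (coeff_ext (k := k) this g).symm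

theorem bosonComul_smash [Fintype Γ] (x : Γ) (r : R) :
    D.bosonComul (D.smash x r) = ∑ g,
      TensorProduct.map (D.smash (g * x)) (D.smash x ∘ₗ D.comp g) (Coalgebra.comul (R := k) r) := by
  simp only [bosonComul, bosonLift_smash, LinearMap.comp_apply]
  generalize Coalgebra.comul (R := k) r = z
  induction z using TensorProduct.induction_on with
  | zero => simp
  | add a b ha hb => simp only [map_add, ha, hb, Finset.sum_add_distrib]
  | tmul a b => simp [coact_eq, TensorProduct.tmul_sum]

theorem comul_mul_apply [Fintype Γ] (r s : R) :
    Coalgebra.comul (R := k) (r * s) =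
      ∑ g, TensorProduct.map₂ (LinearMap.mul k R) (LinearMap.mul k R)
        (TensorProduct.map LinearMap.id (D.comp g) (Coalgebra.comul (R := k) r))
        (TensorProduct.map (D.act g) LinearMap.id (Coalgebra.comul (R := k) s)) := by
  have := LinearMap.congr_fun D.comul_mul (r ⊗ₜ s)
  simp only [LinearMap.comp_apply, LinearMap.mul'_apply, TensorProduct.map_tmul] at this
  rw [this]
  generalize Coalgebra.comul (R := k) r = z
  generalize Coalgebra.comul (R := k) s = w
  induction z using TensorProduct.induction_on with
  | zero => simp
  | add a b ha hb => simp only [map_add, LinearMap.add_apply, ha, hb, Finset.sum_add_distrib,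
      TensorProduct.add_tmul]
  | tmul a b =>
  induction w using TensorProduct.induction_on with
  | zero => simp
  | add a b ha hb => simp only [map_add, ha, hb, Finset.sum_add_distrib, TensorProduct.tmul_add]
  | tmul c d =>
    simp [YetterDrinfeld.braiding, coact_eq, TensorProduct.sum_tmul, TensorProduct.tmul_sum]

theorem boson_coassoc [Fintype Γ] :
    (TensorProduct.assoc k D.Bosonization D.Bosonization D.Bosonization).toLinearMap ∘ₗ
      D.bosonComul.rTensor D.Bosonization ∘ₗ D.bosonComul =
    D.bosonComul.lTensor D.Bosonization ∘ₗ D.bosonComul := by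
  classical
  ext x r
  simp only [LinearMap.comp_apply, bosonComul_smash]
  let A : R ⊗[k] (R ⊗[k] R) →ₗ[k]
      D.Bosonization ⊗[k] (D.Bosonization ⊗[k] D.Bosonization) :=
    ∑ v, ∑ u, TensorProduct.map (D.smash (u * (v * x)))
      (TensorProduct.map (D.smash (v * x) ∘ₗ D.comp u) (D.smash x ∘ₗ D.comp v))
  have hL : ∀ z : R ⊗[k] R,
      TensorProduct.assoc k D.Bosonization D.Bosonization D.Bosonization
        (D.bosonComul.rTensor D.Bosonization
          (∑ g, TensorProduct.map (D.smash (g * x)) (D.smash x ∘ₗ D.comp g) z)) =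
      A (TensorProduct.assoc k R R R ((Coalgebra.comul (R := k)).rTensor R z)) := by
    intro z
    induction z using TensorProduct.induction_on with
    | zero => simp
    | add a b ha hb => simp only [map_add, Finset.sum_add_distrib, ha, hb]
    | tmul a b =>
      simp only [TensorProduct.map_tmul, map_sum, LinearMap.rTensor_tmul, bosonComul_smash]
      generalize Coalgebra.comul (R := k) a = w
      induction w using TensorProduct.induction_on with
      | zero => simp
      | add a b ha hb =>
        simp only [map_add, TensorProduct.add_tmul, Finset.sum_add_distrib, ha, hb]
      | tmul c d => simp [A, TensorProduct.sum_tmul]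
  have hR : ∀ z : R ⊗[k] R,
      D.bosonComul.lTensor D.Bosonization
          (∑ g, TensorProduct.map (D.smash (g * x)) (D.smash x ∘ₗ D.comp g) z) =
      A ((Coalgebra.comul (R := k)).lTensor R z) := by
    intro z
    induction z using TensorProduct.induction_on with
    | zero => simp
    | add a b ha hb => simp only [map_add, Finset.sum_add_distrib, ha, hb]
    | tmul a b =>
      simp only [TensorProduct.map_tmul, map_sum, LinearMap.lTensor_tmul, LinearMap.comp_apply,
        bosonComul_smash, comul_comp]
      generalize Coalgebra.comul (R := k) b = w
      induction w using TensorProduct.induction_on with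
      | zero => simp
      | add a b ha hb =>
        simp only [map_add, TensorProduct.tmul_add, Finset.sum_add_distrib, ha, hb]
      | tmul c d =>
        simp only [TensorProduct.map_tmul, LinearMap.comp_apply, comp_comp, A,
          LinearMap.sum_apply, TensorProduct.tmul_sum, apply_ite (D.smash x), map_zero,
          TensorProduct.tmul_ite]
        rw [Finset.sum_comm]
        refine Finset.sum_congr rfl fun h _ => ?_
        rw [Finset.sum_comm]
        refine Finset.sum_congr rfl fun u _ => ?_
        rw [Finset.sum_eq_single (u * h)]
        · simp [mul_assoc]
        · intro g _ hg
          rw [if_neg]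
          rintro rfl
          simp at hg
        · simp
  rw [LinearEquiv.coe_coe, hL, hR, Coalgebra.coassoc_apply]

instance [Finite Γ] : Coalgebra k D.Bosonization where
  comul := D.bosonComul
  counit := D.bosonCounit
  coassoc := by
    have := Fintype.ofFinite Γ
    exact D.boson_coassoc
  rTensor_counit_comp_comul := by
    have := Fintype.ofFinite Γ
    ext x r
    simp only [LinearMap.comp_apply, bosonComul_smash]
    have h : ∀ z : R ⊗[k] R, D.bosonCounit.rTensor D.Bosonization
        (∑ g, TensorProduct.map (D.smash (g * x)) (D.smash x ∘ₗ D.comp g) z) =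
        (D.smash x).lTensor k ((Coalgebra.counit (R := k)).rTensor R z) := by
      intro z
      induction z using TensorProduct.induction_on with
      | zero => simp
      | add a b ha hb => simp only [map_add, Finset.sum_add_distrib, ha, hb]
      | tmul a b =>
        simp only [bosonCounit, map_sum, TensorProduct.map_tmul, LinearMap.rTensor_tmul,
          LinearMap.comp_apply, bosonLift_smash, LinearMap.lTensor_tmul]
        rw [← TensorProduct.tmul_sum, ← map_sum, sum_comp]
    rw [h]
    simp
  lTensor_counit_comp_comul := by
    classical
    have := Fintype.ofFinite Γ
    ext x r
    simp only [LinearMap.comp_apply, bosonComul_smash]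
    have h : ∀ z : R ⊗[k] R, D.bosonCounit.lTensor D.Bosonization
        (∑ g, TensorProduct.map (D.smash (g * x)) (D.smash x ∘ₗ D.comp g) z) =
        (D.smash x).rTensor k ((Coalgebra.counit (R := k)).lTensor R z) := by
      intro z
      induction z using TensorProduct.induction_on with
      | zero => simp
      | add a b ha hb => simp only [map_add, Finset.sum_add_distrib, ha, hb]
      | tmul a b =>
        simp only [bosonCounit, map_sum, TensorProduct.map_tmul, LinearMap.lTensor_tmul,
          LinearMap.comp_apply, bosonLift_smash, counit_comp, LinearMap.rTensor_tmul]
        rw [Finset.sum_eq_single 1]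
        · simp
        · intro b _ hb
          simp [hb]
        · simp
    rw [h]
    simp

theorem boson_comul_def [Finite Γ] (a : D.Bosonization) :
    Coalgebra.comul (R := k) a = D.bosonComul a := rfl

theorem boson_counit_def [Finite Γ] (a : D.Bosonization) :
    Coalgebra.counit (R := k) a = D.bosonCounit a := rfl

instance [Finite Γ] : Bialgebra k D.Bosonization :=
  Bialgebra.mk' k D.Bosonization
    (by simp [boson_counit_def, bosonCounit, boson_one_def, D.counit_one])
    (by
      intro a b
      simp only [boson_counit_def]
      induction a using D.boson_induction with
      | zero => simp
      | add a a' h h' => simp [add_mul, h, h']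
      | smash x r =>
      induction b using D.boson_induction with
      | zero => simp
      | add a a' h h' => simp [mul_add, h, h']
      | smash y s => simp [bosonCounit, D.counit_mul, D.counit_act])
    (by
      classical
      have := Fintype.ofFinite Γ
      simp only [boson_comul_def, boson_one_def, bosonComul_smash, D.comul_one,
        TensorProduct.map_tmul, LinearMap.comp_apply, comp_one]
      rw [Finset.sum_eq_single 1]
      · simp [Algebra.TensorProduct.one_def, boson_one_def]
      · intro b _ hb
        simp [hb]
      · simp)
    (by
      classical
      have := Fintype.ofFinite Γ
      intro a b
      simp only [boson_comul_def]
      induction a using D.boson_induction with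
      | zero => simp
      | add a a' h h' => simp [add_mul, h, h']
      | smash x r =>
      induction b using D.boson_induction with
      | zero => simp
      | add a a' h h' => simp [mul_add, h, h']
      | smash y s =>
        have hx := LinearMap.congr_fun (D.comul_act x) s
        simp only [LinearMap.comp_apply] at hx
        simp only [smash_mul_smash, bosonComul_smash, D.comul_mul_apply, hx]
        generalize Coalgebra.comul (R := k) r = z
        generalize Coalgebra.comul (R := k) s = w
        induction z using TensorProduct.induction_on with
        | zero => simp
        | add a b ha hb => simp only [map_add, LinearMap.add_apply, ha, hb, Finset.sum_add_distrib,
            add_mul]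
        | tmul a b =>
        induction w using TensorProduct.induction_on with
        | zero => simp
        | add a b ha hb => simp only [map_add, ha, hb, Finset.sum_add_distrib, mul_add]
        | tmul c d =>
          simp only [TensorProduct.map_tmul, TensorProduct.map₂_apply_tmul, LinearMap.comp_apply,
            LinearMap.id_apply, LinearMap.mul_apply', map_sum, Finset.sum_mul_sum,
            Algebra.TensorProduct.tmul_mul_tmul, smash_mul_smash, comp_mul, comp_comp,
            ite_mul, zero_mul, comp_act]
          rw [Finset.sum_comm]
          refine Finset.sum_congr rfl fun g _ => ?_
          rw [← Equiv.sum_comp ((Equiv.mulLeft (g * x)).trans (Equiv.mulRight x⁻¹))]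
          refine Finset.sum_congr rfl fun h _ => ?_
          rw [Finset.sum_eq_single g]
          · simp [mul_assoc]
          · intro b _ hb
            simp [hb]
          · simp)

theorem bosonAntipode_smash [Fintype Γ] (x : Γ) (r : R) :
    D.bosonAntipode (D.smash x r) =
      ∑ g, D.smash (x⁻¹ * g⁻¹) (D.act (x⁻¹ * g⁻¹) (D.antipode (D.comp g r))) := by
  simp [bosonAntipode, groupLift_coact]

instance [Finite Γ] : HopfAlgebra k D.Bosonization where
  antipode := D.bosonAntipode
  mul_antipode_rTensor_comul := by
    classical
    have := Fintype.ofFinite Γ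
    ext x r
    simp only [LinearMap.comp_apply, boson_comul_def, bosonComul_smash]
    have h : ∀ z : R ⊗[k] R, LinearMap.mul' k D.Bosonization (D.bosonAntipode.rTensor _
        (∑ g, TensorProduct.map (D.smash (g * x)) (D.smash x ∘ₗ D.comp g) z)) =
        ∑ u, D.smash (x⁻¹ * u⁻¹ * x) (D.act (x⁻¹ * u⁻¹) (LinearMap.mul' k R (D.antipode.rTensor R
          (∑ h, TensorProduct.map (D.comp h) (D.comp (h⁻¹ * u)) z)))) := by
      intro z
      induction z using TensorProduct.induction_on with
      | zero => simp
      | add a b ha hb => simp only [map_add, Finset.sum_add_distrib, ha, hb]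
      | tmul a b =>
        simp only [map_sum, TensorProduct.map_tmul, LinearMap.rTensor_tmul,
          LinearMap.comp_apply, bosonAntipode_smash, LinearMap.mul'_apply, Finset.sum_mul,
          smash_mul_smash, D.act_mul]
        rw [Finset.sum_comm]
        conv_rhs => rw [Finset.sum_comm]
        refine Finset.sum_congr rfl fun h _ => ?_
        conv_rhs => rw [← Equiv.sum_comp (Equiv.mulLeft h)]
        simp [mul_assoc]
    rw [h]
    have h2 : ∀ u, LinearMap.mul' k R (D.antipode.rTensor R (Coalgebra.comul (R := k)
        (D.comp u r))) = algebraMap k R (Coalgebra.counit (R := k) (D.comp u r)) :=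
      fun u => LinearMap.congr_fun D.antipode_left (D.comp u r)
    simp only [← comul_comp, h2, counit_comp]
    rw [Finset.sum_eq_single 1]
    · simp [Algebra.algebraMap_eq_smul_one, D.act_one, boson_counit_def, bosonCounit,
        boson_one_def]
    · intro b _ hb
      simp [hb]
    · simp
  mul_antipode_lTensor_comul := by
    classical
    have := Fintype.ofFinite Γ
    ext x r
    simp only [LinearMap.comp_apply, boson_comul_def, bosonComul_smash]
    have h : ∀ z : R ⊗[k] R, LinearMap.mul' k D.Bosonization (D.bosonAntipode.lTensor _
        (∑ g, TensorProduct.map (D.smash (g * x)) (D.smash x ∘ₗ D.comp g) z)) =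
        D.smash 1 (LinearMap.mul' k R (D.antipode.lTensor R z)) := by
      intro z
      induction z using TensorProduct.induction_on with
      | zero => simp
      | add a b ha hb => simp only [map_add, Finset.sum_add_distrib, ha, hb]
      | tmul a b =>
        simp only [map_sum, TensorProduct.map_tmul, LinearMap.lTensor_tmul,
          LinearMap.comp_apply, bosonAntipode_smash, LinearMap.mul'_apply, Finset.mul_sum,
          smash_mul_smash, comp_comp]
        conv_rhs => rw [← D.sum_comp b, map_sum, Finset.mul_sum, map_sum]
        refine Finset.sum_congr rfl fun g _ => ?_
        rw [Finset.sum_eq_single g]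
        · simp [mul_assoc]
        · intro h _ hh
          simp [hh]
        · simp
    rw [h]
    have h2 : LinearMap.mul' k R (D.antipode.lTensor R (Coalgebra.comul (R := k) r)) =
        algebraMap k R (Coalgebra.counit (R := k) r) :=
      LinearMap.congr_fun D.antipode_right r
    simp [h2, Algebra.algebraMap_eq_smul_one, boson_counit_def, bosonCounit, boson_one_def]

/-- `R` is an ET-algebra: the coradical is `k 1` and the primitive elements generate `R`. -/
structure IsETAlgebra (_D : BraidedHopfAlgebra k Γ R) : Prop where
  coradical_eq : coradical k R = Submodule.span k {(1 : R)}
  adjoin_primitives : Algebra.adjoin k (primitives k R : Set R) = ⊤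

/-- The braided Hopf algebra structures `E` over `kG` and `D` over `kΓ` on `R` agree, for a subgroup
`G` of `Γ`: the action of `D` restricts to that of `E`, the coaction of `D` takes values in
`kG ⊗ R` and is that of `E`, and the antipodes are equal. -/
structure IsRestriction {G : Subgroup Γ} (E : BraidedHopfAlgebra k G R)
    (D : BraidedHopfAlgebra k Γ R) : Prop where
  act_eq : ∀ x : G, E.act x = D.act (x : Γ)
  coact_eq : D.coact =
    (MonoidAlgebra.mapDomainBialgHom k G.subtype : k[G] →ₗ[k] k[Γ]).rTensor R ∘ₗ E.coact
  antipode_eq : E.antipode = D.antipode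

end BraidedHopfAlgebra

section Induced

variable {k Γ V : Type*} [Field k] [Group Γ] [AddCommGroup V] [Module k V]

/-- The centralizer `Γ_g` of `g`. -/
abbrev isotropy (g : Γ) : Subgroup Γ := Subgroup.centralizer {g}

variable (g : Γ) (ρ : Representation k (isotropy g) V)

/-- The space `kΓ ⊗_{kΓ_g} V` induced from `Γ_g` to `Γ`. In Mathlib's model the class of `x ⊗ v` is
`IndV.mk x⁻¹ v`. -/
abbrev IndSpace : Type _ := Representation.IndV (isotropy g).subtype ρ

/-- The class of `x ⊗ v` in `kΓ ⊗_{kΓ_g} V`. -/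
def indMk (x : Γ) : V →ₗ[k] IndSpace g ρ := Representation.IndV.mk (isotropy g).subtype ρ x⁻¹

theorem indMk_mul (x : Γ) (z : isotropy g) (v : V) :
    indMk g ρ (x * z) v = indMk g ρ x (ρ z v) := by
  have := Representation.Coinvariants.mk_self_apply
    (Representation.tprod ((Representation.leftRegular k Γ).comp (isotropy g).subtype) ρ) z
    (MonoidAlgebra.single (x * z)⁻¹ (1 : k) ⊗ₜ[k] v)
  simpa [indMk] using this.symm

theorem ind_hom_ext {N : Type*} [AddCommGroup N] [Module k N] {f f' : IndSpace g ρ →ₗ[k] N}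
    (h : ∀ x, f ∘ₗ indMk g ρ x = f' ∘ₗ indMk g ρ x) : f = f' :=
  Representation.IndV.hom_ext _ _ fun x => by simpa [indMk] using h x⁻¹

/-- The coaction `δ(x ⊗ v) = x g x⁻¹ ⊗ (x ⊗ v)`. -/
def indCoact : IndSpace g ρ →ₗ[k] k[Γ] ⊗[k] IndSpace g ρ :=
  Representation.Coinvariants.lift _
    (groupLift fun x => TensorProduct.mk k k[Γ] (IndSpace g ρ)
      (MonoidAlgebra.single (x⁻¹ * g * x) 1) ∘ₗ indMk g ρ x⁻¹)
    (by
      intro z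
      ext h v
      have hz : (z : Γ)⁻¹ * g * z = g := by
        have h1 := Subgroup.mem_centralizer_singleton_iff.1 z.2
        rw [mul_assoc, ← h1, inv_mul_cancel_left]
      have := indMk_mul g ρ (h⁻¹ * (z : Γ)⁻¹) z v
      have e : (h⁻¹ * (z : Γ)⁻¹ * g * (z * h) : Γ) = h⁻¹ * g * h := by
        conv_rhs => rw [← hz]
        group
      simp_all [mul_assoc])

theorem indCoact_mk (x : Γ) (v : V) : indCoact g ρ (indMk g ρ x v) =
    MonoidAlgebra.single (x * g * x⁻¹) 1 ⊗ₜ[k] indMk g ρ x v := by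
  simp [indCoact, indMk]

theorem ind_act_mk (h x : Γ) (v : V) :
    Representation.ind (isotropy g).subtype ρ h (indMk g ρ x v) = indMk g ρ (h * x) v := by
  simp [indMk]

/-- The Yetter--Drinfeld module `M(g, ρ) = kΓ ⊗_{kΓ_g} V` over `kΓ`, with
`h (x ⊗ v) = h x ⊗ v` and `δ(x ⊗ v) = x g x⁻¹ ⊗ (x ⊗ v)`. -/
def inducedYD : YetterDrinfeld k Γ (IndSpace g ρ) where
  act := Representation.ind (isotropy g).subtype ρ
  coact := indCoact g ρ
  coact_coassoc := by
    refine ind_hom_ext g ρ fun x => ?_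
    ext v
    simp [indCoact_mk]
  coact_counit := by
    refine ind_hom_ext g ρ fun x => ?_
    ext v
    simp [indCoact_mk]
  coact_act y := by
    refine ind_hom_ext g ρ fun x => ?_
    ext v
    simp only [LinearMap.comp_apply, ind_act_mk, indCoact_mk, TensorProduct.map_tmul, conj_single]
    congr 2
    group

/-- The subgroup generated by the conjugacy class of `g`. -/
def conjSubgroup (g : Γ) : Subgroup Γ := Subgroup.closure (conjugatesOf g)

instance conjSubgroup_normal (g : Γ) : (conjSubgroup g).Normal := by
  have : conjSubgroup g = Subgroup.normalClosure {g} := by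
    simp [conjSubgroup, Subgroup.normalClosure, Group.conjugatesOfSet]
  rw [this]
  infer_instance

end Induced

/-- Exactness of a sequence `k → A → B → C → k` of Hopf algebras, that is, `B` is an extension of
`A` by `C`: `ι` is injective, `π` is surjective, `ker π` is `B ι(A)⁺ = ι(A)⁺ B`, and `ι(A)` is the
space of left, and of right, `C`-coinvariants of `B`. -/
structure IsExactHopfSequence {k A B C : Type*} [Field k] [Ring A] [Ring B] [Ring C]
    [HopfAlgebra k A] [HopfAlgebra k B] [HopfAlgebra k C] (ι : A →ₐc[k] B) (π : B →ₐc[k] C) :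
    Prop where
  injective : Function.Injective ι
  surjective : Function.Surjective π
  ker_eq_left : LinearMap.ker (π : B →ₗ[k] C) =
    Submodule.span k {c | ∃ (b : B) (a : A), Coalgebra.counit (R := k) a = 0 ∧ c = b * ι a}
  ker_eq_right : LinearMap.ker (π : B →ₗ[k] C) =
    Submodule.span k {c | ∃ (b : B) (a : A), Coalgebra.counit (R := k) a = 0 ∧ c = ι a * b}
  range_eq_left : ∀ b : B, b ∈ Set.range ι ↔
    (π : B →ₗ[k] C).rTensor B (Coalgebra.comul (R := k) b) = 1 ⊗ₜ[k] b
  range_eq_right : ∀ b : B, b ∈ Set.range ι ↔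
    (π : B →ₗ[k] C).lTensor B (Coalgebra.comul (R := k) b) = b ⊗ₜ[k] 1

end BraidedHopf
end

/-!
The degrees of `M(g, ρ)` are conjugates of `g`, and the coaction is multiplicative, so an algebra
generated by a copy of `M(g, ρ)` has all its degrees in `G`. Since `kG ⊗ M → kΓ ⊗ M` is injective
for every `M`, each axiom for the restricted structure on `R` follows by cancelling this map.

As `r₍₋₁₎` lies in `kG` for all `r`, it disappears in `k(Γ/G)`, so that
`(π ⊗ id) Δ(r # x) = xG ⊗ (r # x)`; likewise `(id ⊗ π) Δ(r # x) = (r # x) ⊗ xG` because `ε` is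
colinear. Hence the coinvariants, on either side, are the sum of the `R # x` with `x ∈ G`. Modulo
`B A⁺`, and modulo `A⁺ B`, the element `r # x` becomes `ε(r) (1 # x)` and `1 # x` depends only on
the coset `xG`; so every element of `ker π` vanishes there.
-/

noncomputable section

namespace BraidedHopf

section SubgroupTensor

variable {k Γ M N : Type*} [Field k] [Group Γ] [AddCommGroup M] [Module k M]
  [AddCommGroup N] [Module k N] (G : Subgroup Γ)

variable (k M) in
/-- The embedding `kG ⊗ M → kΓ ⊗ M` for a subgroup `G` of `Γ`. -/
def subgroupTensor : k[G] ⊗[k] M →ₗ[k] k[Γ] ⊗[k] M :=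
  (MonoidAlgebra.mapDomainBialgHom k G.subtype : k[G] →ₗ[k] k[Γ]).rTensor M

@[simp]
theorem subgroupTensor_single_tmul (x : G) (a : k) (m : M) :
    subgroupTensor k M G (MonoidAlgebra.single x a ⊗ₜ[k] m) =
      MonoidAlgebra.single (x : Γ) a ⊗ₜ[k] m := by
  simp [subgroupTensor]

theorem mapDomainBialgHom_subtype_injective :
    Function.Injective (MonoidAlgebra.mapDomainBialgHom k G.subtype : k[G] →ₗ[k] k[Γ]) :=
  MonoidAlgebra.mapDomain_injective G.subtype_injective

theorem subgroupTensor_injective : Function.Injective (subgroupTensor k M G) :=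
  Module.Flat.rTensor_preserves_injective_linearMap _ (mapDomainBialgHom_subtype_injective G)

theorem lTensor_subgroupTensor (f : M →ₗ[k] N) (z : k[G] ⊗[k] M) :
    f.lTensor k[Γ] (subgroupTensor k M G z) = subgroupTensor k N G (f.lTensor k[G] z) :=
  (LinearMap.congr_fun (LinearMap.lTensor_comp_rTensor ..) z).trans
    (LinearMap.congr_fun (LinearMap.rTensor_comp_lTensor ..) z).symm

theorem map_conj_subgroupTensor (x : G) (f : M →ₗ[k] M) (z : k[G] ⊗[k] M) :
    TensorProduct.map (conj k (x : Γ)) f (subgroupTensor k M G z) =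
      subgroupTensor k M G (TensorProduct.map (conj k x) f z) := by
  induction z using tensor_induction with
  | zero => simp only [map_zero]
  | add a b ha hb => simp only [map_add, ha, hb]
  | tmul y m => simp

theorem groupLift_subgroupTensor (f : Γ → M →ₗ[k] N) (z : k[G] ⊗[k] M) :
    groupLift f (subgroupTensor k M G z) = groupLift (fun x : G => f x) z := by
  induction z using tensor_induction with
  | zero => simp only [map_zero]
  | add a b ha hb => simp only [map_add, ha, hb]
  | tmul y m => simp

omit [Group Γ] in
theorem map_groupLift {P : Type*} [AddCommGroup P] [Module k P] (h : N →ₗ[k] P)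
    (f : Γ → M →ₗ[k] N) (z : k[Γ] ⊗[k] M) :
    h (groupLift f z) = groupLift (fun x => h ∘ₗ f x) z := by
  induction z using tensor_induction with
  | zero => simp only [map_zero]
  | add a b ha hb => simp only [map_add, ha, hb]
  | tmul x m => simp

omit [Group Γ] in
theorem groupLift_comp {P : Type*} [AddCommGroup P] [Module k P] (f : Γ → N →ₗ[k] P)
    (h : M →ₗ[k] N) (z : k[Γ] ⊗[k] M) :
    groupLift (fun x => f x ∘ₗ h) z = groupLift f (h.lTensor k[Γ] z) := by
  induction z using tensor_induction with
  | zero => simp only [map_zero]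
  | add a b ha hb => simp only [map_add, ha, hb]
  | tmul x m => simp

omit [Group Γ] in
theorem groupLift_leftComm_tmul {P : Type*} [AddCommGroup P] [Module k P]
    (f : Γ → M ⊗[k] N →ₗ[k] P) (m : M) (z : k[Γ] ⊗[k] N) :
    groupLift f (TensorProduct.leftComm k M k[Γ] N (m ⊗ₜ[k] z)) =
      groupLift (fun x => f x ∘ₗ TensorProduct.mk k M N m) z := by
  induction z using tensor_induction with
  | zero => simp only [map_zero, TensorProduct.tmul_zero]
  | add a b ha hb => simp only [map_add, TensorProduct.tmul_add, ha, hb]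
  | tmul x n => simp

variable (k Γ M N) in
/-- The map `(kΓ ⊗ M) ⊗ (kΓ ⊗ N) → kΓ ⊗ (M ⊗ N)`, `(x ⊗ m) ⊗ (y ⊗ n) ↦ xy ⊗ (m ⊗ n)`, which turns
the coactions of two comodules into the codiagonal coaction. -/
def codiagonal : (k[Γ] ⊗[k] M) ⊗[k] (k[Γ] ⊗[k] N) →ₗ[k] k[Γ] ⊗[k] (M ⊗[k] N) :=
  (LinearMap.mul' k k[Γ]).rTensor (M ⊗[k] N) ∘ₗ
    (TensorProduct.tensorTensorTensorComm k k[Γ] M k[Γ] N).toLinearMap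

theorem codiagonal_tmul_subgroupTensor (z : k[G] ⊗[k] M) (w : k[G] ⊗[k] N) :
    codiagonal k Γ M N (subgroupTensor k M G z ⊗ₜ[k] subgroupTensor k N G w) =
      subgroupTensor k (M ⊗[k] N) G (codiagonal k G M N (z ⊗ₜ[k] w)) := by
  induction z using tensor_induction with
  | zero => simp only [map_zero, TensorProduct.zero_tmul]
  | add a b ha hb => simp only [map_add, TensorProduct.add_tmul, ha, hb]
  | tmul x m =>
    induction w using tensor_induction with
    | zero => simp only [map_zero, TensorProduct.tmul_zero]
    | add a b ha hb => simp only [map_add, TensorProduct.tmul_add, ha, hb]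
    | tmul y n => simp [codiagonal, MonoidAlgebra.single_mul_single]

end SubgroupTensor

namespace YetterDrinfeld

variable {k Γ M N : Type*} [Field k] [Group Γ] [AddCommGroup M] [Module k M]
  [AddCommGroup N] [Module k N] {X : YetterDrinfeld k Γ M} {Y : YetterDrinfeld k Γ N}
  {G : Subgroup Γ}

theorem tensorCoact_tmul (X : YetterDrinfeld k Γ M) (Y : YetterDrinfeld k Γ N) (m : M) (n : N) :
    X.tensorCoact Y (m ⊗ₜ[k] n) = codiagonal k Γ M N (X.coact m ⊗ₜ[k] Y.coact n) :=
  rfl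

variable (X G) in
/-- The space of all `m` with `δ(m) ∈ kG ⊗ M`. -/
def supported : Submodule k M := (LinearMap.range (subgroupTensor k M G)).comap X.coact

theorem IsHom.map_mem_supported {f : M →ₗ[k] N} (hf : X.IsHom Y f) {m : M}
    (hm : m ∈ X.supported G) : f m ∈ Y.supported G := by
  obtain ⟨z, hz⟩ := hm
  refine ⟨f.lTensor k[G] z, ?_⟩
  rw [← lTensor_subgroupTensor, hz]
  exact (LinearMap.congr_fun hf.map_coact m).symm

theorem groupLift_coact_of_mem_supported {P : Type*} [AddCommGroup P] [Module k P] {m : M}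
    (hm : m ∈ X.supported G) {f : Γ → M →ₗ[k] P} {F : M →ₗ[k] P} (hf : ∀ x ∈ G, f x = F) :
    groupLift f (X.coact m) = F m := by
  have hF : groupLift (fun _ => F) = F ∘ₗ (TensorProduct.lid k M).toLinearMap ∘ₗ
      (Coalgebra.counit (R := k) (A := k[Γ])).rTensor M := by
    ext x n
    simp
  obtain ⟨z, hz⟩ := hm
  calc groupLift f (X.coact m) = groupLift (fun _ => F) (X.coact m) := by
        simp only [← hz, groupLift_subgroupTensor, fun x : G => hf x x.2]
    _ = F m := by
        rw [hF]
        exact congrArg F (LinearMap.congr_fun X.coact_counit m)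

section Restrict

variable (hX : X.supported G = ⊤) (hY : Y.supported G = ⊤)

/-- The coaction of `kG` on a Yetter--Drinfeld module over `kΓ` whose coaction takes values in
`kG ⊗ M`. -/
def restrictCoact : M →ₗ[k] k[G] ⊗[k] M :=
  (LinearEquiv.ofInjective _ (subgroupTensor_injective G)).symm.toLinearMap ∘ₗ
    X.coact.codRestrict _ (Submodule.eq_top_iff'.1 hX)

@[simp]
theorem subgroupTensor_restrictCoact (m : M) :
    subgroupTensor k M G (restrictCoact hX m) = X.coact m :=
  congrArg Subtype.val
    ((LinearEquiv.ofInjective _ (subgroupTensor_injective G)).apply_symm_apply _)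

theorem restrictCoact_coassoc :
    (TensorProduct.assoc k k[G] k[G] M).toLinearMap ∘ₗ
      (Coalgebra.comul (R := k) (A := k[G])).rTensor M ∘ₗ restrictCoact hX =
    (restrictCoact hX).lTensor k[G] ∘ₗ restrictCoact hX := by
  set J := (MonoidAlgebra.mapDomainBialgHom k G.subtype : k[G] →ₗ[k] k[Γ])
  have hJ : Function.Injective (TensorProduct.map J (subgroupTensor k M G)) :=
    TensorProduct.map_injective_of_flat_flat _ _ (mapDomainBialgHom_subtype_injective G)
      (subgroupTensor_injective G)
  have hcomul : TensorProduct.map J (subgroupTensor k M G) ∘ₗ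
      (TensorProduct.assoc k k[G] k[G] M).toLinearMap ∘ₗ (Coalgebra.comul (R := k)).rTensor M =
      (TensorProduct.assoc k k[Γ] k[Γ] M).toLinearMap ∘ₗ
        (Coalgebra.comul (R := k)).rTensor M ∘ₗ subgroupTensor k M G := by
    ext x m
    simp [J]
  have hcoact : TensorProduct.map J (subgroupTensor k M G) ∘ₗ (restrictCoact hX).lTensor k[G] =
      X.coact.lTensor k[Γ] ∘ₗ subgroupTensor k M G := by
    ext x m
    simp [J]
  ext m
  refine hJ ?_
  refine (LinearMap.congr_fun hcomul _).trans (Eq.trans ?_ (LinearMap.congr_fun hcoact _).symm)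
  simp only [LinearMap.comp_apply, subgroupTensor_restrictCoact]
  exact LinearMap.congr_fun X.coact_coassoc m

theorem restrictCoact_counit :
    (TensorProduct.lid k M).toLinearMap ∘ₗ
      (Coalgebra.counit (R := k) (A := k[G])).rTensor M ∘ₗ restrictCoact hX = LinearMap.id := by
  have hcounit : (Coalgebra.counit (R := k)).rTensor M =
      (Coalgebra.counit (R := k)).rTensor M ∘ₗ subgroupTensor k M G := by
    ext x m
    simp
  ext m
  simp only [LinearMap.comp_apply, hcounit, subgroupTensor_restrictCoact]
  exact LinearMap.congr_fun X.coact_counit m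

/-- The Yetter--Drinfeld module over `kG` obtained by restricting the action to `G` and the range
of the coaction to `kG ⊗ M`. -/
def restrict : YetterDrinfeld k G M where
  act := X.act.comp G.subtype
  coact := restrictCoact hX
  coact_coassoc := restrictCoact_coassoc hX
  coact_counit := restrictCoact_counit hX
  coact_act x := by
    ext m
    refine subgroupTensor_injective G ?_
    simp only [LinearMap.comp_apply, ← map_conj_subgroupTensor, subgroupTensor_restrictCoact]
    exact LinearMap.congr_fun (X.coact_act x) m

@[simp]
theorem subgroupTensor_restrict_coact (m : M) :
    subgroupTensor k M G ((restrict hX).coact m) = X.coact m :=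
  subgroupTensor_restrictCoact hX m

theorem subgroupTensor_restrict_tensorCoact (z : M ⊗[k] N) :
    subgroupTensor k (M ⊗[k] N) G ((restrict hX).tensorCoact (restrict hY) z) =
      X.tensorCoact Y z := by
  induction z using TensorProduct.induction_on with
  | zero => simp only [map_zero]
  | add a b ha hb => simp only [map_add, ha, hb]
  | tmul m n =>
    simp only [tensorCoact_tmul, ← codiagonal_tmul_subgroupTensor, subgroupTensor_restrict_coact]

theorem braiding_restrict : (restrict hX).braiding (restrict hY) = X.braiding Y := by
  have hassoc (z : k[G] ⊗[k] M) (n : N) :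
      subgroupTensor k (M ⊗[k] N) G (TensorProduct.assoc k k[G] M N (z ⊗ₜ[k] n)) =
        TensorProduct.assoc k k[Γ] M N (subgroupTensor k M G z ⊗ₜ[k] n) := by
    induction z using tensor_induction with
    | zero => simp only [map_zero, TensorProduct.zero_tmul]
    | add a b ha hb => simp only [map_add, TensorProduct.add_tmul, ha, hb]
    | tmul x m => simp
  refine TensorProduct.ext' fun m n => ?_
  simp only [braiding, LinearMap.comp_apply, LinearMap.rTensor_tmul, LinearEquiv.coe_coe,
    ← subgroupTensor_restrict_coact hX, ← hassoc, groupLift_subgroupTensor]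
  rfl

theorem IsHom.restrict {f : M →ₗ[k] N} (hf : X.IsHom Y f) :
    (restrict hX).IsHom (restrict hY) f where
  map_act x := hf.map_act x
  map_coact := by
    ext m
    refine subgroupTensor_injective G ?_
    simp only [LinearMap.comp_apply, ← lTensor_subgroupTensor, subgroupTensor_restrict_coact]
    exact LinearMap.congr_fun hf.map_coact m

end Restrict

end YetterDrinfeld

namespace BraidedHopfAlgebra

open YetterDrinfeld

variable {k Γ R : Type*} [Field k] [Group Γ] [Ring R] [Algebra k R] [Coalgebra k R]
  {D : BraidedHopfAlgebra k Γ R} {G : Subgroup Γ}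

theorem one_mem_supported : 1 ∈ D.supported G :=
  ⟨1 ⊗ₜ[k] 1, by simp [D.coact_one, MonoidAlgebra.one_def]⟩

theorem mul_mem_supported {r s : R} (hr : r ∈ D.supported G) (hs : s ∈ D.supported G) :
    r * s ∈ D.supported G := by
  obtain ⟨z, hz⟩ := hr
  obtain ⟨w, hw⟩ := hs
  refine ⟨(LinearMap.mul' k R).lTensor k[G] (codiagonal k G R R (z ⊗ₜ[k] w)), ?_⟩
  rw [← lTensor_subgroupTensor, ← codiagonal_tmul_subgroupTensor, hz, hw, ← tensorCoact_tmul]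
  exact (LinearMap.congr_fun D.coact_mul (r ⊗ₜ[k] s)).symm

theorem supported_eq_top_of_adjoin_eq_top {s : Set R} (hs : Algebra.adjoin k s = ⊤)
    (hsG : s ⊆ D.supported G) : D.supported G = ⊤ := by
  let A : Subalgebra k R :=
    (D.supported G).toSubalgebra one_mem_supported fun _ _ => mul_mem_supported
  have hA : Algebra.adjoin k s ≤ A := Algebra.adjoin_le hsG
  exact Submodule.eq_top_iff'.2 fun r => hA (hs ▸ Algebra.mem_top)

/-- The Hopf algebra in the category of Yetter--Drinfeld modules over `kG` obtained from one over
`kΓ` whose coaction takes values in `kG ⊗ R`. -/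
def restrict (hG : D.supported G = ⊤) : BraidedHopfAlgebra k G R where
  toYetterDrinfeld := YetterDrinfeld.restrict hG
  act_one x := D.act_one x
  coact_one := by
    refine subgroupTensor_injective G ?_
    rw [subgroupTensor_restrict_coact, D.coact_one]
    simp [MonoidAlgebra.one_def]
  act_mul x := D.act_mul x
  coact_mul := by
    ext r s
    refine subgroupTensor_injective G ?_
    simpa [← lTensor_subgroupTensor, subgroupTensor_restrict_tensorCoact] using
      LinearMap.congr_fun D.coact_mul (r ⊗ₜ[k] s)
  counit_act x := D.counit_act x
  counit_coact r := by
    refine subgroupTensor_injective G ?_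
    rw [← lTensor_subgroupTensor, subgroupTensor_restrict_coact, D.counit_coact]
    simp [MonoidAlgebra.one_def]
  comul_act x := D.comul_act x
  comul_coact := by
    ext r
    refine subgroupTensor_injective G ?_
    simpa [← lTensor_subgroupTensor, subgroupTensor_restrict_tensorCoact] using
      LinearMap.congr_fun D.comul_coact r
  counit_one := D.counit_one
  counit_mul := D.counit_mul
  comul_one := D.comul_one
  comul_mul := by
    rw [braiding_restrict]
    exact D.comul_mul
  antipode := D.antipode
  antipode_hom := D.antipode_hom.restrict hG hG
  antipode_left := D.antipode_left
  antipode_right := D.antipode_right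

theorem isRestriction_restrict (hG : D.supported G = ⊤) : (restrict hG).IsRestriction D where
  act_eq _ := rfl
  coact_eq := LinearMap.ext fun r => (subgroupTensor_restrict_coact hG r).symm
  antipode_eq := rfl

theorem map_bosonComul_smash {P : Type*} [AddCommGroup P] [Module k P]
    (h : D.Bosonization ⊗[k] D.Bosonization →ₗ[k] P) {F : R ⊗[k] R →ₗ[k] P} {x : Γ}
    (hF : ∀ a b, groupLift (fun g => h ∘ₗ TensorProduct.map (D.smash (g * x)) (D.smash x) ∘ₗ
      TensorProduct.mk k R R a) (D.coact b) = F (a ⊗ₜ[k] b)) (r : R) :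
    h (D.bosonComul (D.smash x r)) = F (Coalgebra.comul (R := k) r) := by
  rw [bosonComul, bosonLift_smash]
  refine LinearMap.congr_fun (f := h ∘ₗ groupLift _ ∘ₗ _ ∘ₗ D.coact.lTensor R)
    (TensorProduct.ext' fun a b => ?_) (Coalgebra.comul (R := k) r)
  simp only [LinearMap.comp_apply, LinearMap.lTensor_tmul, LinearEquiv.coe_coe,
    groupLift_leftComm_tmul, map_groupLift, hF]

namespace IsRestriction

variable {E : BraidedHopfAlgebra k G R} (hE : E.IsRestriction D)

include hE

theorem subgroupTensor_coact (r : R) : subgroupTensor k R G (E.coact r) = D.coact r :=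
  (LinearMap.congr_fun hE.coact_eq r).symm

theorem supported_eq_top : D.supported G = ⊤ :=
  Submodule.eq_top_iff'.2 fun r => ⟨E.coact r, hE.subgroupTensor_coact r⟩

omit hE in
variable (D E) in
/-- The linear map `R # kG → R # kΓ`, `r # x ↦ r # x`. -/
def inclLinearMap : E.Bosonization →ₗ[k] D.Bosonization := E.bosonLift fun x => D.smash (x : Γ)

omit hE in
@[simp]
theorem inclLinearMap_smash (x : G) (r : R) :
    inclLinearMap D E (E.smash x r) = D.smash (x : Γ) r :=
  E.bosonLift_smash _ x r

theorem inclLinearMap_mul (a b : E.Bosonization) :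
    inclLinearMap D E (a * b) = inclLinearMap D E a * inclLinearMap D E b := by
  induction a using E.boson_induction with
  | zero => simp
  | add a a' h h' => simp only [add_mul, map_add, h, h']
  | smash x r =>
    induction b using E.boson_induction with
    | zero => simp
    | add b b' h h' => simp only [mul_add, map_add, h, h']
    | smash y s => simp [hE.act_eq]

theorem map_inclLinearMap_bosonComul_smash (x : G) (r : R) :
    TensorProduct.map (inclLinearMap D E) (inclLinearMap D E) (E.bosonComul (E.smash x r)) =
      D.bosonComul (D.smash (x : Γ) r) := by
  let F : R ⊗[k] R →ₗ[k] D.Bosonization ⊗[k] D.Bosonization :=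
    groupLift (fun g => TensorProduct.map (D.smash (g * x)) (D.smash (x : Γ))) ∘ₗ
      (TensorProduct.leftComm k R k[Γ] R).toLinearMap ∘ₗ D.coact.lTensor R
  rw [map_bosonComul_smash _ (F := F) fun a b => ?_]
  · rw [bosonComul, bosonLift_smash]
    rfl
  · simp only [F, LinearMap.comp_apply, LinearMap.lTensor_tmul, LinearEquiv.coe_coe,
      groupLift_leftComm_tmul, ← hE.subgroupTensor_coact b, groupLift_subgroupTensor]
    congr 2
    ext g c
    simp

/-- The Hopf algebra morphism `R # kG → R # kΓ`, `r # x ↦ r # x`. -/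
def incl [Finite Γ] : E.Bosonization →ₐc[k] D.Bosonization :=
  { inclLinearMap D E with
    counit_comp := by
      ext x r
      simp [boson_counit_def, bosonCounit]
    map_comp_comul := by
      ext x r
      simpa [boson_comul_def] using hE.map_inclLinearMap_bosonComul_smash x r
    map_one' := by simp [boson_one_def]
    map_mul' := hE.inclLinearMap_mul }

@[simp]
theorem incl_smash [Finite Γ] (x : G) (r : R) : hE.incl (E.smash x r) = D.smash (x : Γ) r :=
  inclLinearMap_smash x r

omit hE in
variable (D E) in
/-- The linear retraction of `R # kG → R # kΓ` which sends `r # x` to `0` for `x ∉ G`. -/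
def retraction : D.Bosonization →ₗ[k] E.Bosonization :=
  open Classical in D.bosonLift fun x => if hx : x ∈ G then E.smash ⟨x, hx⟩ else 0

omit hE in
theorem retraction_smash_of_mem {x : Γ} (hx : x ∈ G) (r : R) :
    retraction D E (D.smash x r) = E.smash ⟨x, hx⟩ r := by
  simp [retraction, hx]

omit hE in
theorem retraction_smash_of_notMem {x : Γ} (hx : x ∉ G) (r : R) :
    retraction D E (D.smash x r) = 0 := by
  simp [retraction, hx]

theorem retraction_incl [Finite Γ] (a : E.Bosonization) : retraction D E (hE.incl a) = a := by
  induction a using E.boson_induction with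
  | zero => simp
  | add a b ha hb => simp only [map_add, ha, hb]
  | smash x r => rw [incl_smash, retraction_smash_of_mem x.2]

theorem incl_injective [Finite Γ] : Function.Injective hE.incl :=
  Function.LeftInverse.injective hE.retraction_incl

end IsRestriction

variable (D G) in
/-- The linear map `R # kΓ → k(Γ/G)`, `r # x ↦ ε(r) xG`. -/
def quotientLinearMap : D.Bosonization →ₗ[k] k[Γ ⧸ G] :=
  D.bosonLift fun x => MonoidAlgebra.lsingle (x : Γ ⧸ G) ∘ₗ Coalgebra.counit (R := k) (A := R)

@[simp]
theorem quotientLinearMap_smash (x : Γ) (r : R) :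
    D.quotientLinearMap G (D.smash x r) =
      MonoidAlgebra.single (x : Γ ⧸ G) (Coalgebra.counit (R := k) r) :=
  D.bosonLift_smash _ x r

theorem quotientLinearMap_mul [G.Normal] (a b : D.Bosonization) :
    D.quotientLinearMap G (a * b) = D.quotientLinearMap G a * D.quotientLinearMap G b := by
  induction a using D.boson_induction with
  | zero => simp
  | add a a' h h' => simp only [add_mul, map_add, h, h']
  | smash x r =>
    induction b using D.boson_induction with
    | zero => simp
    | add b b' h h' => simp only [mul_add, map_add, h, h']
    | smash y s => simp [D.counit_mul, D.counit_act, MonoidAlgebra.single_mul_single]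

theorem rTensor_quotientLinearMap_bosonComul_smash [G.Normal] (hG : D.supported G = ⊤) (x : Γ)
    (r : R) : (D.quotientLinearMap G).rTensor D.Bosonization (D.bosonComul (D.smash x r)) =
      MonoidAlgebra.single (x : Γ ⧸ G) 1 ⊗ₜ[k] D.smash x r := by
  let F : R ⊗[k] R →ₗ[k] k[Γ ⧸ G] ⊗[k] D.Bosonization :=
    TensorProduct.mk k _ _ (MonoidAlgebra.single (x : Γ ⧸ G) 1) ∘ₗ D.smash x ∘ₗ
      (TensorProduct.lid k R).toLinearMap ∘ₗ (Coalgebra.counit (R := k)).rTensor R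
  rw [map_bosonComul_smash _ (F := F) fun a b => ?_]
  · simp [F]
  · refine YetterDrinfeld.groupLift_coact_of_mem_supported (F := F ∘ₗ TensorProduct.mk k R R a)
      (hG ▸ Submodule.mem_top) fun g hg => ?_
    have hgx : ((g * x : Γ) : Γ ⧸ G) = x := by
      rw [QuotientGroup.mk_mul, (QuotientGroup.eq_one_iff g).2 hg, one_mul]
    ext c
    simp [F, hgx, TensorProduct.smul_tmul']

theorem lTensor_quotientLinearMap_bosonComul_smash (x : Γ) (r : R) :
    (D.quotientLinearMap G).lTensor D.Bosonization (D.bosonComul (D.smash x r)) =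
      D.smash x r ⊗ₜ[k] MonoidAlgebra.single (x : Γ ⧸ G) 1 := by
  let F : R ⊗[k] R →ₗ[k] D.Bosonization ⊗[k] k[Γ ⧸ G] :=
    (TensorProduct.mk k _ _).flip (MonoidAlgebra.single (x : Γ ⧸ G) 1) ∘ₗ D.smash x ∘ₗ
      (TensorProduct.rid k R).toLinearMap ∘ₗ (Coalgebra.counit (R := k)).lTensor R
  rw [map_bosonComul_smash _ (F := F) fun a b => ?_]
  · simp [F]
  · have hcomp (g : Γ) : (D.quotientLinearMap G).lTensor D.Bosonization ∘ₗ
        TensorProduct.map (D.smash (g * x)) (D.smash x) ∘ₗ TensorProduct.mk k R R a =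
        (LinearMap.toSpanSingleton k _ (D.smash (g * x) a ⊗ₜ[k]
          MonoidAlgebra.single (x : Γ ⧸ G) 1)) ∘ₗ Coalgebra.counit (R := k) := by
      ext b
      simp [← TensorProduct.tmul_smul]
    simp only [hcomp, groupLift_comp, D.counit_coact]
    simp [F, MonoidAlgebra.one_def, TensorProduct.smul_tmul']

theorem ker_quotientLinearMap_le {I : Submodule k D.Bosonization}
    (hcoset : ∀ x y : Γ, (x : Γ ⧸ G) = y → D.smash x 1 - D.smash y 1 ∈ I)
    (hcounit : ∀ (x : Γ) (r : R), Coalgebra.counit (R := k) r = 0 → D.smash x r ∈ I) :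
    LinearMap.ker (D.quotientLinearMap G) ≤ I := by
  let σ : k[Γ ⧸ G] →ₗ[k] D.Bosonization ⧸ I :=
    Finsupp.linearCombination k (fun c : Γ ⧸ G => I.mkQ (D.smash c.out 1)) ∘ₗ
      (MonoidAlgebra.coeffLinearEquiv k).toLinearMap
  have hσ : σ ∘ₗ D.quotientLinearMap G = I.mkQ := by
    ext x r
    set e := Coalgebra.counit (R := k) r with he
    have hr : I.mkQ (D.smash x r) = I.mkQ (D.smash x (e • 1)) := by
      rw [← sub_eq_zero, ← map_sub, ← map_sub]
      exact (Submodule.Quotient.mk_eq_zero I).2 (hcounit x _ (by simp [D.counit_one, he]))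
    have hx : I.mkQ (D.smash (x : Γ ⧸ G).out 1) = I.mkQ (D.smash x 1) := by
      rw [← sub_eq_zero, ← map_sub]
      exact (Submodule.Quotient.mk_eq_zero I).2 (hcoset _ _ (QuotientGroup.out_eq' _))
    simp only [LinearMap.comp_apply, quotientLinearMap_smash, hr, map_smul, ← hx, ← he]
    simp [σ]
  rw [← I.ker_mkQ, ← hσ]
  exact LinearMap.ker_le_ker_comp _ _

section Finite

variable [Finite Γ] [G.Normal] (hG : D.supported G = ⊤)

/-- The Hopf algebra morphism `R # kΓ → k(Γ/G)`, `r # x ↦ ε(r) xG`. -/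
def quotientMap : D.Bosonization →ₐc[k] k[Γ ⧸ G] :=
  { D.quotientLinearMap G with
    counit_comp := by
      ext x r
      simp [boson_counit_def, bosonCounit]
    map_comp_comul := by
      ext x r
      change TensorProduct.map (D.quotientLinearMap G) (D.quotientLinearMap G)
        (D.bosonComul (D.smash x r)) = Coalgebra.comul (D.quotientLinearMap G (D.smash x r))
      rw [← LinearMap.lTensor_comp_rTensor, LinearMap.comp_apply,
        rTensor_quotientLinearMap_bosonComul_smash hG]
      simp
    map_one' := by simp [boson_one_def, D.counit_one, MonoidAlgebra.one_def]
    map_mul' := quotientLinearMap_mul }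

@[simp]
theorem quotientMap_smash (x : Γ) (r : R) : quotientMap hG (D.smash x r) =
    MonoidAlgebra.single (x : Γ ⧸ G) (Coalgebra.counit (R := k) r) :=
  quotientLinearMap_smash x r

theorem quotientMap_surjective : Function.Surjective (quotientMap hG) := by
  intro c
  induction c using MonoidAlgebra.induction_linear with
  | zero => exact ⟨0, map_zero _⟩
  | add a b ha hb =>
    obtain ⟨a, rfl⟩ := ha
    obtain ⟨b, rfl⟩ := hb
    exact ⟨a + b, map_add _ _ _⟩
  | single x a =>
    obtain ⟨x, rfl⟩ := QuotientGroup.mk_surjective x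
    exact ⟨D.smash x (a • 1), by simp [D.counit_one]⟩

end Finite

namespace IsRestriction

variable [Finite Γ] [G.Normal] {E : BraidedHopfAlgebra k G R} (hE : E.IsRestriction D)

include hE

theorem quotientMap_incl (a : E.Bosonization) : quotientMap hE.supported_eq_top (hE.incl a) =
    algebraMap k k[Γ ⧸ G] (Coalgebra.counit (R := k) a) := by
  induction a using E.boson_induction with
  | zero => simp
  | add a b ha hb => simp only [map_add, ha, hb]
  | smash x r => simp [boson_counit_def, bosonCounit, (QuotientGroup.eq_one_iff (x : Γ)).2 x.2]

theorem ker_quotientMap_eq_left :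
    LinearMap.ker (quotientMap hE.supported_eq_top : D.Bosonization →ₗ[k] k[Γ ⧸ G]) =
      Submodule.span k {c | ∃ (b : D.Bosonization) (a : E.Bosonization),
        Coalgebra.counit (R := k) a = 0 ∧ c = b * hE.incl a} := by
  refine le_antisymm (ker_quotientLinearMap_le (fun x y hxy => Submodule.subset_span ?_)
    fun x r hr => Submodule.subset_span ?_) (Submodule.span_le.2 ?_)
  · refine ⟨D.smash y 1, E.smash ⟨y⁻¹ * x, QuotientGroup.eq.1 hxy.symm⟩ 1 - 1, ?_, ?_⟩
    · simp [boson_counit_def, bosonCounit, boson_one_def, D.counit_one]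
    · simp [mul_sub, D.act_one]
  · refine ⟨D.smash x 1, E.smash 1 (D.act x⁻¹ r), ?_, ?_⟩
    · simp [boson_counit_def, bosonCounit, D.counit_act, hr]
    · simp
  · rintro _ ⟨b, a, ha, rfl⟩
    change quotientMap hE.supported_eq_top (b * hE.incl a) = 0
    rw [map_mul, hE.quotientMap_incl, ha, map_zero, mul_zero]

theorem ker_quotientMap_eq_right :
    LinearMap.ker (quotientMap hE.supported_eq_top : D.Bosonization →ₗ[k] k[Γ ⧸ G]) =
      Submodule.span k {c | ∃ (b : D.Bosonization) (a : E.Bosonization),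
        Coalgebra.counit (R := k) a = 0 ∧ c = hE.incl a * b} := by
  refine le_antisymm (ker_quotientLinearMap_le (fun x y hxy => Submodule.subset_span ?_)
    fun x r hr => Submodule.subset_span ?_) (Submodule.span_le.2 ?_)
  · have hxyG : x * y⁻¹ ∈ G := by
      rw [← div_eq_mul_inv]
      exact QuotientGroup.eq_iff_div_mem.1 hxy
    refine ⟨D.smash y 1, E.smash ⟨x * y⁻¹, hxyG⟩ 1 - 1, ?_, ?_⟩
    · simp [boson_counit_def, bosonCounit, boson_one_def, D.counit_one]
    · simp [sub_mul, D.act_one]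
  · refine ⟨D.smash x 1, E.smash 1 r, ?_, ?_⟩
    · simp [boson_counit_def, bosonCounit, hr]
    · simp
  · rintro _ ⟨b, a, ha, rfl⟩
    change quotientMap hE.supported_eq_top (hE.incl a * b) = 0
    rw [map_mul, hE.quotientMap_incl, ha, map_zero, zero_mul]

theorem mem_range_incl_iff_left (b : D.Bosonization) : b ∈ Set.range hE.incl ↔
    (quotientMap hE.supported_eq_top : D.Bosonization →ₗ[k] k[Γ ⧸ G]).rTensor D.Bosonization
      (Coalgebra.comul (R := k) b) = 1 ⊗ₜ[k] b := by
  classical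
  constructor
  · rintro ⟨a, rfl⟩
    induction a using E.boson_induction with
    | zero => simp
    | add a b ha hb => simp only [map_add, TensorProduct.tmul_add, ha, hb]
    | smash x r =>
      rw [hE.incl_smash, MonoidAlgebra.one_def, ← (QuotientGroup.eq_one_iff (x : Γ)).2 x.2]
      exact rTensor_quotientLinearMap_bosonComul_smash hE.supported_eq_top x r
  · intro hb
    let T : k[Γ ⧸ G] ⊗[k] D.Bosonization →ₗ[k] D.Bosonization :=
      groupLift fun c => if c = 1 then LinearMap.id else 0
    have hT : T ∘ₗ (D.quotientLinearMap G).rTensor D.Bosonization ∘ₗ D.bosonComul =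
        (hE.incl : E.Bosonization →ₗ[k] D.Bosonization) ∘ₗ retraction D E := by
      ext x r
      simp only [LinearMap.comp_apply,
        rTensor_quotientLinearMap_bosonComul_smash hE.supported_eq_top]
      by_cases hx : x ∈ G
      · simp [T, (QuotientGroup.eq_one_iff x).2 hx, retraction_smash_of_mem hx]
      · simp [T, (QuotientGroup.eq_one_iff x).not.2 hx, retraction_smash_of_notMem hx]
    refine ⟨retraction D E b, ?_⟩
    calc hE.incl (retraction D E b) = T (1 ⊗ₜ[k] b) :=
          (LinearMap.congr_fun hT b).symm.trans (congrArg T hb)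
      _ = b := by simp [T, MonoidAlgebra.one_def]

theorem mem_range_incl_iff_right (b : D.Bosonization) : b ∈ Set.range hE.incl ↔
    (quotientMap hE.supported_eq_top : D.Bosonization →ₗ[k] k[Γ ⧸ G]).lTensor D.Bosonization
      (Coalgebra.comul (R := k) b) = b ⊗ₜ[k] 1 := by
  have hcomm : (TensorProduct.comm k D.Bosonization k[Γ ⧸ G]).toLinearMap ∘ₗ
      (D.quotientLinearMap G).lTensor D.Bosonization ∘ₗ D.bosonComul =
      (D.quotientLinearMap G).rTensor D.Bosonization ∘ₗ D.bosonComul := by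
    ext x r
    simp [rTensor_quotientLinearMap_bosonComul_smash hE.supported_eq_top,
      lTensor_quotientLinearMap_bosonComul_smash]
  rw [hE.mem_range_incl_iff_left, ← TensorProduct.comm_tmul, ← EquivLike.apply_eq_iff_eq
    (TensorProduct.comm k D.Bosonization k[Γ ⧸ G])]
  exact Eq.congr_left (LinearMap.congr_fun hcomm b).symm

theorem isExactHopfSequence :
    IsExactHopfSequence hE.incl (quotientMap hE.supported_eq_top) where
  injective := hE.incl_injective
  surjective := quotientMap_surjective hE.supported_eq_top
  ker_eq_left := hE.ker_quotientMap_eq_left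
  ker_eq_right := hE.ker_quotientMap_eq_right
  range_eq_left := hE.mem_range_incl_iff_left
  range_eq_right := hE.mem_range_incl_iff_right

end IsRestriction

end BraidedHopfAlgebra

section Induced

variable {k Γ V : Type*} [Field k] [Group Γ] [AddCommGroup V] [Module k V]

theorem conj_mem_conjSubgroup (g x : Γ) : x * g * x⁻¹ ∈ conjSubgroup g :=
  Subgroup.subset_closure (isConj_iff.2 ⟨x, rfl⟩)

theorem inducedYD_supported_conjSubgroup (g : Γ) (ρ : Representation k (isotropy g) V) :
    (inducedYD g ρ).supported (conjSubgroup g) = ⊤ := by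
  rw [← Submodule.ker_mkQ ((inducedYD g ρ).supported (conjSubgroup g)), LinearMap.ker_eq_top]
  refine ind_hom_ext g ρ fun x => LinearMap.ext fun v => ?_
  refine (Submodule.Quotient.mk_eq_zero _).2
    ⟨MonoidAlgebra.single ⟨x * g * x⁻¹, conj_mem_conjSubgroup g x⟩ 1 ⊗ₜ[k] indMk g ρ x v, ?_⟩
  rw [subgroupTensor_single_tmul]
  exact (indCoact_mk g ρ x v).symm

theorem range_le_supported_conjSubgroup {N : Type*} [AddCommGroup N] [Module k N]
    {Y : YetterDrinfeld k Γ N} {g : Γ} {ρ : Representation k (isotropy g) V}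
    {φ : IndSpace g ρ →ₗ[k] N} (hφ : (inducedYD g ρ).IsHom Y φ) :
    LinearMap.range φ ≤ Y.supported (conjSubgroup g) := by
  rintro _ ⟨v, rfl⟩
  exact hφ.map_mem_supported (inducedYD_supported_conjSubgroup g ρ ▸ Submodule.mem_top)

end Induced

end BraidedHopf
end

theorem mainTheorem8_general {k Γ R : Type*} [Field k] [Group Γ] [Finite Γ] [Ring R] [Algebra k R]
    [Coalgebra k R] (D : BraidedHopf.BraidedHopfAlgebra k Γ R) (G : Subgroup Γ) [G.Normal]
    {s : Set R} (hs : Algebra.adjoin k s = ⊤) (hsG : s ⊆ D.supported G) :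
    ∃ E : BraidedHopf.BraidedHopfAlgebra k G R, E.IsRestriction D ∧
      ∃ (ι : E.Bosonization →ₐc[k] D.Bosonization) (π : D.Bosonization →ₐc[k] k[Γ ⧸ G]),
        (∀ (x : G) (r : R), ι (E.smash x r) = D.smash (x : Γ) r) ∧
        (∀ (x : Γ) (r : R), π (D.smash x r) =
          MonoidAlgebra.single (x : Γ ⧸ G) (Coalgebra.counit (R := k) r)) ∧
        BraidedHopf.IsExactHopfSequence ι π := by
  have hG := BraidedHopf.BraidedHopfAlgebra.supported_eq_top_of_adjoin_eq_top hs hsG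
  have hE := BraidedHopf.BraidedHopfAlgebra.isRestriction_restrict hG
  exact ⟨_, hE, hE.incl, BraidedHopf.BraidedHopfAlgebra.quotientMap hG, hE.incl_smash,
    BraidedHopf.BraidedHopfAlgebra.quotientMap_smash hG, hE.isExactHopfSequence⟩

theorem mainTheorem8 {k Γ R V : Type*} [Field k] [Group Γ] [Finite Γ]
    [Ring R] [Algebra k R] [Coalgebra k R] [AddCommGroup V] [Module k V]
    (D : BraidedHopf.BraidedHopfAlgebra k Γ R) (hD : D.IsETAlgebra)
    (g : Γ) (ρ : Representation k (BraidedHopf.isotropy g) V) (hρ : ρ.IsIrreducible)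
    (hP : ∃ φ : BraidedHopf.IndSpace g ρ →ₗ[k] R, Function.Injective φ ∧
      (BraidedHopf.inducedYD g ρ).IsHom D.toYetterDrinfeld φ ∧
      LinearMap.range φ = BraidedHopf.primitives k R) :
    ∃ E : BraidedHopf.BraidedHopfAlgebra k (BraidedHopf.conjSubgroup g) R, E.IsRestriction D ∧
      ∃ (ι : E.Bosonization →ₐc[k] D.Bosonization)
        (π : D.Bosonization →ₐc[k] MonoidAlgebra k (Γ ⧸ BraidedHopf.conjSubgroup g)),
        (∀ (x : BraidedHopf.conjSubgroup g) (r : R), ι (E.smash x r) = D.smash (x : Γ) r) ∧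
        (∀ (x : Γ) (r : R), π (D.smash x r) =
          MonoidAlgebra.single (x : Γ ⧸ BraidedHopf.conjSubgroup g)
            (Coalgebra.counit (R := k) r)) ∧
        BraidedHopf.IsExactHopfSequence ι π := by
  obtain ⟨φ, -, hφ, hφP⟩ := hP
  exact mainTheorem8_general D _ hD.adjoin_primitives
    (hφP ▸ BraidedHopf.range_le_supported_conjSubgroup hφ)
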